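/- Let $K\ge 2$, $\sigma>0$, $\delta\in(0,1)$, and consider a Gaussian bandit with arms $1,\dots,K$: in each round $n=1,2,\dots$ a reward vector $(Y_{n,1},\dots,Y_{n,K})$ with $Y_{n,i}\sim\mathcal N(\mu_i,\sigma^2)$ is generated independently of the past, and only $Y_{n,I_n}$ is revealed, where the arm $I_n$ is chosen by an arbitrary sampling rule from the past observations $(I_\ell,Y_{\ell,I_\ell})_{\ell<n}$ and exogenous randomization. Assume that the best arm $I^\star=\operatorname{argmax}_i\mu_i$ is unique. Put $$T_{n,i}=\sum_{\ell=1}^{n-1}\mathbf 1\{I_\ell=i\},\qquad \mu_{n,i}=\frac1{T_{n,i}}\sum_{\ell=1}^{n-1}\mathbf 1\{I_\ell=i\}Y_{\ell,I_\ell}.$$ Once every arm has been pulled ($T_{n,i}\ge1$ for all $i$), let $\Pi_n=\bigotimes_{i=1}^K\mathcal N(\mu_{n,i},\sigma^2/T_{n,i})$ be the posterior under the improper flat prior, and let $a_{n,i}=\Pi_n(\theta_i>\max_{j\ne i}\theta_j)$. Let $W_n(i,j)=0$ if $\mu_{n,j}\ge\mu_{n,i}$ or if $T_{n,i}T_{n,j}=0$,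 and otherwise $$W_n(i,j)=T_{n,i}\,d(\mu_{n,i};\mu_{n,i,j})+T_{n,j}\,d(\mu_{n,j};\mu_{n,i,j}),$$ where $d(m;m')=\frac{(m-m')^2}{2\sigma^2}$ and $\mu_{n,i,j}=\frac{T_{n,i}\mu_{n,i}+T_{n,j}\mu_{n,j}}{T_{n,i}+T_{n,j}}$. With $\zeta$ the Riemann zeta function, define $$g_G(\lambda)=2\lambda-2\lambda\ln(4\lambda)+\ln\zeta(2\lambda)-\tfrac12\ln(1-\lambda),\qquad \mathcal C^{g_G}(x)=\inf_{1/2<\lambda<1}\frac{g_G(\lambda)+x}{\lambda},$$ and the thresholds $$d_{n,\delta}=4\ln(4+\ln n)+2\,\mathcal C^{g_G}\!\left(\tfrac12\ln\tfrac{K-1}{\delta}\right),\qquad c_{n,\delta}=1-\frac1{\sqrt{2\pi}}\,e^{-\left(\sqrt{d_{n,\delta}}+\frac1{\sqrt2}\right)^2}.$$ Then, whatever the sampling rule, $\mathbb P(\tau_\delta<\infty\ \wedge\ J_{\tau_\delta}\ne I^\star)\le\delta$ holds in each of the following two cases: 1. (Bayesian stopping rule) $\tau_\delta=\inf\{n\ge1:\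 T_{n,i}\ge 1\text{ for all }i,\ \max_i a_{n,i}\ge c_{n,\delta}\}$ and $J_n\in\operatorname{argmax}_i a_{n,i}$; 2. (Chernoff stopping rule) $\tau_\delta=\inf\{n\ge1:\ \max_i\min_{j\ne i}W_n(i,j)>d_{n,\delta}\}$ and $J_n\in\operatorname{argmax}_i\mu_{n,i}$. Ties in the argmax may be broken arbitrarily; $J_n$ may be arbitrary as long as some arm has not been pulled. -/

import Mathlib

open MeasureTheory ProbabilityTheory

noncomputable section

namespace TopTwo

/-- The information `F n` available after `n` rounds (rounds are numbered `1, 2, …`): it is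
generated by the exogenous variables `U 0, …, U n`, the arms `arm 1, …, arm n` and the revealed
rewards `Y ℓ (arm ℓ)`, `1 ≤ ℓ ≤ n`. The variable `U n` is used for the choice made in round
`n + 1`. -/
abbrev history {Ω : Type*} {K : ℕ} (U : ℕ → Ω → ℝ) (Y : ℕ → Fin K → Ω → ℝ) (arm : ℕ → Ω → Fin K)
    (n : ℕ) : MeasurableSpace Ω :=
  (⨆ ℓ ∈ Finset.range (n + 1), MeasurableSpace.comap (U ℓ) inferInstance) ⊔
    (⨆ ℓ ∈ Finset.Icc 1 n,
      (MeasurableSpace.comap (arm ℓ) inferInstance ⊔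
        MeasurableSpace.comap (fun ω => Y ℓ (arm ℓ ω) ω) inferInstance))

/-- A Gaussian bandit with arm means `μ` and common standard deviation `σ`, played with an
arbitrary sampling rule. In round `n + 1` the arm `arm (n + 1)` is selected on the basis of the
past observations and exogenous randomness only, and the reward vector
`(Y (n + 1) i)_i` is independent of the past. Rounds are numbered from `1`; `Y 0` and `arm 0` are
not used. No particular law is imposed on the exogenous variables `U n`. -/
structure GaussianBandit {Ω : Type*} [MeasurableSpace Ω] (P : Measure Ω) (K : ℕ)
    (μ : Fin K → ℝ) (σ : ℝ) where
  /-- exogenous randomness -/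
  U : ℕ → Ω → ℝ
  /-- `Y n i` is the reward of arm `i` in round `n` -/
  Y : ℕ → Fin K → Ω → ℝ
  /-- `arm n` is the arm selected in round `n` -/
  arm : ℕ → Ω → Fin K
  measurable_U : ∀ n, Measurable (U n)
  measurable_Y : ∀ n i, Measurable (Y (n + 1) i)
  law_Y : ∀ n i, P.map (Y (n + 1) i) = gaussianReal (μ i) (Real.toNNReal (σ ^ 2))
  measurable_arm : ∀ n, Measurable[history U Y arm n] (arm (n + 1))
  indep_Y : ∀ n, Indep (MeasurableSpace.comap (fun ω i => Y (n + 1) i ω) inferInstance)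
    (history U Y arm n) P

namespace GaussianBandit

variable {Ω : Type*} [MeasurableSpace Ω] {P : Measure Ω} {K : ℕ} {μ : Fin K → ℝ} {σ : ℝ}

/-- `T_{n,i}`: the number of selections of arm `i` before round `n`. -/
def pulls (B : GaussianBandit P K μ σ) (n : ℕ) (i : Fin K) (ω : Ω) : ℕ :=
  ((Finset.Ico 1 n).filter (fun ℓ => B.arm ℓ ω = i)).card

/-- Every arm was selected before round `n`; equivalently, the posterior at round `n` under the
improper flat prior is a probability distribution. -/
def AllPulled (B : GaussianBandit P K μ σ) (n : ℕ) (ω : Ω) : Prop :=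
  ∀ i, 0 < B.pulls n i ω

/-- `μ_{n,i}`: the empirical mean of arm `i` before round `n`. -/
def empMean (B : GaussianBandit P K μ σ) (n : ℕ) (i : Fin K) (ω : Ω) : ℝ :=
  (∑ ℓ ∈ Finset.Ico 1 n, if B.arm ℓ ω = i then B.Y ℓ (B.arm ℓ ω) ω else 0) / (B.pulls n i ω : ℝ)

/-- `Π_n`: the posterior for the improper flat prior, a product of Gaussian laws with means
`μ_{n,i}` and variances `σ² / T_{n,i}` (meaningful when every arm has been selected). -/
def posterior (B : GaussianBandit P K μ σ) (n : ℕ) (ω : Ω) : Measure (Fin K → ℝ) :=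
  Measure.pi fun i =>
    gaussianReal (B.empMean n i ω) (Real.toNNReal (σ ^ 2 / (B.pulls n i ω : ℝ)))

/-- `a_{n,i}`: the posterior probability that arm `i` is the (strictly) best arm. -/
def optProb (B : GaussianBandit P K μ σ) (n : ℕ) (i : Fin K) (ω : Ω) : ℝ :=
  (B.posterior n ω).real {θ | ∀ j, j ≠ i → θ j < θ i}

end GaussianBandit

/-- The Kullback-Leibler divergence `d(m; m')` between `N(m, σ²)` and `N(m', σ²)`. -/
def gaussKL (σ m m' : ℝ) : ℝ := (m - m') ^ 2 / (2 * σ ^ 2)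

namespace GaussianBandit

variable {Ω : Type*} [MeasurableSpace Ω] {P : Measure Ω} {K : ℕ} {μ : Fin K → ℝ} {σ : ℝ}

/-- `μ_{n,i,j}`: the pooled empirical mean of arms `i` and `j`. -/
def pooledMean (B : GaussianBandit P K μ σ) (n : ℕ) (i j : Fin K) (ω : Ω) : ℝ :=
  ((B.pulls n i ω : ℝ) * B.empMean n i ω + (B.pulls n j ω : ℝ) * B.empMean n j ω) /
    ((B.pulls n i ω : ℝ) + (B.pulls n j ω : ℝ))

open Classical in
/-- `W_n(i,j)`: the transportation cost. It is `0` when arm `i` or arm `j` has not been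
selected. -/
def transportCost (B : GaussianBandit P K μ σ) (n : ℕ) (i j : Fin K) (ω : Ω) : ℝ :=
  if B.empMean n i ω ≤ B.empMean n j ω then 0
  else
    (B.pulls n i ω : ℝ) * gaussKL σ (B.empMean n i ω) (B.pooledMean n i j ω) +
      (B.pulls n j ω : ℝ) * gaussKL σ (B.empMean n j ω) (B.pooledMean n i j ω)

end GaussianBandit

/-- `g_G(s) = 2s - 2s ln(4s) + ln ζ(2s) - (1/2) ln(1-s)`, for `1/2 < s < 1`. -/
def gG (s : ℝ) : ℝ :=
  2 * s - 2 * s * Real.log (4 * s) + Real.log (riemannZeta ((2 * s : ℝ) : ℂ)).re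
    - 1 / 2 * Real.log (1 - s)

/-- `C^{g_G}(x) = min_{1/2 < s ≤ 1} (g_G(s) + x) / s`. Since `g_G(1) = +∞`, the endpoint `1` does
not contribute. -/
def CgG (x : ℝ) : ℝ :=
  sInf ((fun s : ℝ => (gG s + x) / s) '' Set.Ioo (1 / 2 : ℝ) 1)

/-- The threshold `d_{n,δ}` of the Chernoff stopping rule with `K` arms. -/
def dThreshold (K n : ℕ) (δ : ℝ) : ℝ :=
  4 * Real.log (4 + Real.log (n : ℝ)) + 2 * CgG (Real.log (((K : ℝ) - 1) / δ) / 2)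

/-- The threshold `c_{n,δ}` of the Bayesian stopping rule with `K` arms. -/
def cThreshold (K n : ℕ) (δ : ℝ) : ℝ :=
  1 - 1 / Real.sqrt (2 * Real.pi) *
    Real.exp (-(Real.sqrt (dThreshold K n δ) + 1 / Real.sqrt 2) ^ 2)

namespace GaussianBandit

variable {Ω : Type*} [MeasurableSpace Ω] {P : Measure Ω} {K : ℕ} {μ : Fin K → ℝ} {σ : ℝ}

/-- The Bayesian stopping rule: the first `n ≥ 1` with a proper posterior such that
`max_i a_{n,i} ≥ c_{n,δ}` (and `∞` if there is none). -/
def bayesStop (B : GaussianBandit P K μ σ) (δ : ℝ) (ω : Ω) : ℕ∞ :=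
  sInf ((fun n : ℕ => (n : ℕ∞)) ''
    {n : ℕ | 1 ≤ n ∧ B.AllPulled n ω ∧ cThreshold K n δ ≤ ⨆ i, B.optProb n i ω})

/-- The Chernoff stopping rule: the first `n ≥ 1` such that
`max_i min_{j ≠ i} W_n(i,j) > d_{n,δ}` (and `∞` if there is none). -/
def chernoffStop (B : GaussianBandit P K μ σ) (δ : ℝ) (ω : Ω) : ℕ∞ :=
  sInf ((fun n : ℕ => (n : ℕ∞)) ''
    {n : ℕ | 1 ≤ n ∧
      dThreshold K n δ < ⨆ i : Fin K, ⨅ j : {j : Fin K // j ≠ i}, B.transportCost n i j ω})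

/-- `J n` is a maximizer of `i ↦ a_{n,i}` whenever the posterior is proper (ties broken
arbitrarily). -/
def IsBayesRecommendation (B : GaussianBandit P K μ σ) (J : ℕ → Ω → Fin K) : Prop :=
  ∀ n ω, B.AllPulled n ω → ∀ i, B.optProb n i ω ≤ B.optProb n (J n ω) ω

/-- `J n` is an empirical best arm whenever all empirical means are defined (ties broken
arbitrarily). -/
def IsEmpiricalRecommendation (B : GaussianBandit P K μ σ) (J : ℕ → Ω → Fin K) : Prop :=
  ∀ n ω, B.AllPulled n ω → ∀ i, B.empMean n i ω ≤ B.empMean n (J n ω) ω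

end GaussianBandit

end TopTwo

end

/-! Under either rule, a wrong answer `i` at the stopping time forces `W_n(i, best) > d_{n,δ}`, so
it suffices to bound the probability that this ever happens, uniformly in `n`
(`measure_exists_ne_lt_transportCost_le`, a union bound over the `K - 1` suboptimal arms).

For fixed `i`, let `S_k` be the sum of the standardized rewards revealed by arm `k`, and `T_k` its
number of pulls. Since `μ i < μ best`, a positive cost `W_n(i, best)` is at most the sum of `S_k² /
(2 T_k)` over the two arms (`transportCost_le_of_pos`). For each tilt `θ`, `∏ exp (θ_k S_k - θ_k²
T_k / 2)` is a martingale under any sampling rule, and so is its mixture over a product prior. With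
a suitable countable Gaussian mixture as prior, each factor is at least `exp (s (S² / (2T) - 2 log
(4 + log T)) - gG s)` (`ofReal_exp_le_lintegral_mixturePrior`). Ville's inequality then bounds the
crossing probability for each `s`, and optimizing over `s` produces `CgG`.

For the Chernoff rule, `W > d > 0` makes the leading arm the unique empirical best. For the Bayesian
rule, the posterior probability that `best` is at least as good as `i` is at least the standard
normal tail at `√(2W)`, which exceeds the density at `√(2W) + 1`; the form of `c_{n,δ}` turns this
into `W > d`. -/

namespace TopTwo

open scoped ENNReal NNReal

/-! ### Maximal inequality for supermartingales. -/

/-- Ville's maximal inequality for a nonnegative supermartingale, in terms of lower integrals. -/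
theorem mul_measure_exists_le_lintegral {Ω : Type*} {m0 : MeasurableSpace Ω} (P : Measure Ω)
    (F : Filtration ℕ m0) (f : ℕ → Ω → ℝ≥0∞) (hf : ∀ n, Measurable[F n] (f n))
    (hstep : ∀ n A, MeasurableSet[F n] A → ∫⁻ ω in A, f (n + 1) ω ∂P ≤ ∫⁻ ω in A, f n ω ∂P)
    (ε : ℝ≥0∞) : ε * P {ω | ∃ n, ε ≤ f n ω} ≤ ∫⁻ ω, f 0 ω ∂P := by
  set U : ℕ → Set Ω := fun N => {ω | ∃ n ≤ N, ε ≤ f n ω} with hU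
  have hUF : ∀ N, MeasurableSet[F N] (U N) := by
    intro N
    have : U N = ⋃ n ∈ Finset.range (N + 1), {ω | ε ≤ f n ω} := by
      ext ω; simp [hU]
    rw [this]
    refine Finset.measurableSet_biUnion _ fun n hn => ?_
    exact F.mono (Nat.lt_succ_iff.mp (Finset.mem_range.mp hn)) _
      (hf n measurableSet_Ici)
  -- The left side is a lower bound for the mean of the process stopped at its first passage above
  -- `ε`: at least `ε` where passage has occurred by time `N`, and `f N` elsewhere.
  have hbound : ∀ N, ε * P (U N) + ∫⁻ ω in (U N)ᶜ, f N ω ∂P ≤ ∫⁻ ω, f 0 ω ∂P := by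
    intro N
    induction N with
    | zero =>
      have h0 := F.le 0 _ (hUF 0)
      refine le_of_le_of_eq ?_ (lintegral_add_compl (f 0) h0)
      refine add_le_add_left ?_ _
      rw [← setLIntegral_const]
      exact setLIntegral_mono' h0 fun ω hω => by simpa [hU] using hω
    | succ N ih =>
      refine le_trans ?_ ih
      have hN := F.le N _ (hUF N)
      have hN1 := F.le _ _ (hUF (N + 1))
      have hsub : U N ⊆ U (N + 1) := fun ω ⟨n, hn, h⟩ => ⟨n, hn.trans (Nat.le_succ _), h⟩
      calc ε * P (U (N + 1)) + ∫⁻ ω in (U (N + 1))ᶜ, f (N + 1) ω ∂P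
          = ε * P (U N) + (∫⁻ ω in U (N + 1) \ U N, ε ∂P
              + ∫⁻ ω in (U (N + 1))ᶜ, f (N + 1) ω ∂P) := by
            rw [setLIntegral_const, ← add_assoc, ← mul_add, measure_add_sdiff hN.nullMeasurableSet,
              Set.union_eq_self_of_subset_left hsub]
        _ ≤ ε * P (U N) + (∫⁻ ω in U (N + 1) \ U N, f (N + 1) ω ∂P
              + ∫⁻ ω in (U (N + 1))ᶜ, f (N + 1) ω ∂P) := by
            refine add_le_add_right (add_le_add_left ?_ _) _
            refine setLIntegral_mono' (hN1.diff hN) fun ω hω => ?_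
            obtain ⟨⟨n, hn, h⟩, hω'⟩ := hω
            rcases Nat.le_succ_iff.mp hn with hn | rfl
            · exact absurd ⟨n, hn, h⟩ hω'
            · exact h
        _ = ε * P (U N) + ∫⁻ ω in (U N)ᶜ, f (N + 1) ω ∂P := by
            rw [← lintegral_union hN1.compl
              (Set.disjoint_left.mpr fun ω hω h => h hω.1)]
            congr 3
            ext ω
            have := @hsub ω
            simp only [Set.mem_union, Set.mem_sdiff, Set.mem_compl_iff]
            tauto
        _ ≤ _ := by
            exact add_le_add_right (hstep N _ (hUF N).compl) _
  have hUnion : {ω | ∃ n, ε ≤ f n ω} = ⋃ N, U N := by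
    ext ω
    simp only [hU, Set.mem_ofPred_eq, Set.mem_iUnion]
    exact ⟨fun ⟨n, h⟩ => ⟨n, n, le_rfl, h⟩, fun ⟨_, n, _, h⟩ => ⟨n, h⟩⟩
  have hmono : Monotone U := fun M N h ω ⟨n, hn, hω⟩ => ⟨n, hn.trans h, hω⟩
  rw [hUnion, hmono.measure_iUnion, ENNReal.mul_iSup]
  exact iSup_le fun N => le_self_add.trans (hbound N)

/-! ### The Gaussian mixture and its lower bound. -/

theorem hasSum_rpow_neg_riemannZeta_re {s : ℝ} (hs : 1 < s) :
    HasSum (fun n : ℕ => ((n : ℝ) + 1) ^ (-s)) (riemannZeta (s : ℂ)).re := by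
  have hsum : Summable (fun n : ℕ => ((n : ℝ) + 1) ^ (-s)) := by
    have := (summable_nat_add_iff 1).mpr (Real.summable_nat_rpow.mpr (neg_lt_neg hs))
    simpa using this
  have key : riemannZeta (s : ℂ) = ((∑' n : ℕ, ((n : ℝ) + 1) ^ (-s) : ℝ) : ℂ) := by
    rw [zeta_eq_tsum_one_div_nat_add_one_cpow (by simpa using hs), Complex.ofReal_tsum]
    refine tsum_congr fun n => ?_
    rw [Complex.ofReal_cpow (by positivity)]
    push_cast
    rw [Complex.cpow_neg, one_div]
  rw [key, Complex.ofReal_re]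
  exact hsum.hasSum

theorem one_le_riemannZeta_re {s : ℝ} (hs : 1 < s) : 1 ≤ (riemannZeta (s : ℂ)).re := by
  have h := hasSum_rpow_neg_riemannZeta_re hs
  have := le_hasSum h 0 fun n _ => by positivity
  simpa using this

/-- Completing the square: the tilt turns precision `c` and mean `0` into precision `c + T` and mean
`S / (c + T)`; the right side is the normalizing constant. -/
theorem lintegral_exp_gaussianReal_zero {c : ℝ} (hc : 0 < c) (S : ℝ) {T : ℝ} (hT : 0 ≤ T) :
    ∫⁻ η, ENNReal.ofReal (Real.exp (η * S - η ^ 2 * T / 2)) ∂(gaussianReal 0 (Real.toNNReal c⁻¹))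
      = ENNReal.ofReal (√(c / (c + T)) * Real.exp (S ^ 2 / (2 * (c + T)))) := by
  have hcT : 0 < c + T := by positivity
  have hv : Real.toNNReal c⁻¹ ≠ 0 := by simpa using hc
  have hv' : Real.toNNReal (c + T)⁻¹ ≠ 0 := by simpa using hcT
  have hpt : ∀ η, gaussianPDFReal 0 (Real.toNNReal c⁻¹) η * Real.exp (η * S - η ^ 2 * T / 2)
      = (√(c / (c + T)) * Real.exp (S ^ 2 / (2 * (c + T))))
        * gaussianPDFReal (S / (c + T)) (Real.toNNReal (c + T)⁻¹) η := by
    intro η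
    simp only [gaussianPDFReal, Real.coe_toNNReal _ (inv_nonneg.mpr hc.le),
      Real.coe_toNNReal _ (inv_nonneg.mpr hcT.le)]
    have h1 : (√(2 * Real.pi * c⁻¹))⁻¹ = √(c / (c + T)) * (√(2 * Real.pi * (c + T)⁻¹))⁻¹ := by
      rw [← Real.sqrt_inv, ← Real.sqrt_inv, ← Real.sqrt_mul (by positivity)]
      congr 1
      field_simp
    rw [h1]
    have h2 : Real.exp (-(η - 0) ^ 2 / (2 * c⁻¹)) * Real.exp (η * S - η ^ 2 * T / 2)
        = Real.exp (S ^ 2 / (2 * (c + T))) *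
          Real.exp (-(η - S / (c + T)) ^ 2 / (2 * (c + T)⁻¹)) := by
      rw [← Real.exp_add, ← Real.exp_add]
      congr 1
      field_simp
      ring
    linear_combination (√(c / (c + T)) * (√(2 * Real.pi * (c + T)⁻¹))⁻¹) * h2
  rw [gaussianReal_of_var_ne_zero _ hv,
    lintegral_withDensity_eq_lintegral_mul _ (measurable_gaussianPDF _ _) (by fun_prop)]
  have : ∀ η, (gaussianPDF 0 (Real.toNNReal c⁻¹) *
        fun η => ENNReal.ofReal (Real.exp (η * S - η ^ 2 * T / 2))) η
      = ENNReal.ofReal (√(c / (c + T)) * Real.exp (S ^ 2 / (2 * (c + T))))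
        * gaussianPDF (S / (c + T)) (Real.toNNReal (c + T)⁻¹) η := by
    intro η
    simp only [Pi.mul_apply, gaussianPDF]
    rw [← ENNReal.ofReal_mul (gaussianPDFReal_nonneg _ _ _), hpt,
      ENNReal.ofReal_mul (by positivity)]
  simp_rw [this]
  rw [lintegral_const_mul _ (measurable_gaussianPDF _ _), lintegral_gaussianPDF_eq_one _ hv',
    mul_one]

/-- The precision of the `k`-th Gaussian component of the mixture `mixturePrior`. -/
noncomputable def mixturePrecision (s : ℝ) (k : ℕ) : ℝ := Real.exp (4 * s * k) * ((1 - s) / s)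

/-- A mixture of centered Gaussian laws with precisions `e ^ (4 s k) (1 - s) / s` and weights
proportional to `(k + 1) ^ (-2 s)`. -/
noncomputable def mixturePrior (s : ℝ) : Measure ℝ :=
  Measure.sum fun k : ℕ =>
    ENNReal.ofReal (((k : ℝ) + 1) ^ (-(2 * s)) / (riemannZeta ((2 * s : ℝ) : ℂ)).re) •
      gaussianReal 0 (Real.toNNReal (mixturePrecision s k)⁻¹)

theorem isProbabilityMeasure_mixturePrior {s : ℝ} (hs : 1 / 2 < s) :
    IsProbabilityMeasure (mixturePrior s) := by
  have h2 : 1 < 2 * s := by linarith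
  have hz := one_le_riemannZeta_re h2
  have hsum := (hasSum_rpow_neg_riemannZeta_re h2).div_const (riemannZeta ((2 * s : ℝ) : ℂ)).re
  rw [div_self (by positivity)] at hsum
  constructor
  simp only [mixturePrior, Measure.sum_apply _ MeasurableSet.univ, Measure.smul_apply,
    measure_univ, smul_eq_mul, mul_one]
  rw [← ENNReal.ofReal_tsum_of_nonneg (fun n => by positivity) hsum.summable, hsum.tsum_eq,
    ENNReal.ofReal_one]

/-- The mixture with prior `mixturePrior s` dominates the exponential of `s` times the
self-normalized deviation, up to an iterated logarithm and the constant `gG s`. -/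
theorem ofReal_exp_le_lintegral_mixturePrior {s : ℝ} (hs : s ∈ Set.Ioo (1 / 2 : ℝ) 1) (S : ℝ)
    {T : ℝ} (hT : 1 ≤ T) :
    ENNReal.ofReal (Real.exp (s * (S ^ 2 / (2 * T) - 2 * Real.log (4 + Real.log T)) - gG s)) ≤
      ∫⁻ η, ENNReal.ofReal (Real.exp (η * S - η ^ 2 * T / 2)) ∂(mixturePrior s) := by
  obtain ⟨hs1, hs2⟩ := hs
  have hs0 : 0 < s := by linarith
  have h1s : 0 < 1 - s := by linarith
  have h2 : 1 < 2 * s := by linarith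
  have hT0 : 0 < T := by linarith
  have hlogT : 0 ≤ Real.log T := Real.log_nonneg hT
  set z := (riemannZeta ((2 * s : ℝ) : ℂ)).re with hzdef
  have hz : 1 ≤ z := one_le_riemannZeta_re h2
  -- Only one mixture component is kept: the one whose precision lies within a factor `exp (4 * s)`
  -- below `T (1 - s) / s`. The upper bound on `c` gives `s (c + T) ≤ T`, hence the exponent; the
  -- lower bound controls `√(c / (c + T))`.
  set k := ⌊Real.log T / (4 * s)⌋₊ with hk
  have hk1 : 4 * s * k ≤ Real.log T := by
    have := Nat.floor_le (div_nonneg hlogT (by positivity : 0 ≤ 4 * s))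
    rw [le_div_iff₀ (by positivity)] at this
    linarith
  have hk2 : Real.log T ≤ 4 * s * k + 4 * s := by
    have := (Nat.lt_floor_add_one (Real.log T / (4 * s))).le
    rw [div_le_iff₀ (by positivity)] at this
    rw [hk]; linarith
  set c := mixturePrecision s k with hcdef
  have hc : 0 < c := by rw [hcdef, mixturePrecision]; positivity
  have hcT : c ≤ T * ((1 - s) / s) := by
    rw [hcdef, mixturePrecision]
    gcongr
    rwa [← Real.le_log_iff_exp_le hT0]
  have hTc : T ≤ Real.exp (4 * s) * (s / (1 - s)) * c := by
    have : Real.exp (4 * s) * (s / (1 - s)) * c = Real.exp (4 * s * k + 4 * s) := by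
      rw [hcdef, mixturePrecision, Real.exp_add]
      field_simp
    rw [this, ← Real.log_le_iff_le_exp hT0]
    exact hk2
  have hexpo : s * (S ^ 2 / (2 * T)) ≤ S ^ 2 / (2 * (c + T)) := by
    have : s * (c + T) ≤ T := by
      have : s * c ≤ T * (1 - s) := by
        calc s * c ≤ s * (T * ((1 - s) / s)) := by gcongr
          _ = T * (1 - s) := by field_simp
      linarith
    rw [le_div_iff₀ (by positivity)]
    calc s * (S ^ 2 / (2 * T)) * (2 * (c + T)) = S ^ 2 * ((s * (c + T)) / T) := by field_simp
      _ ≤ S ^ 2 * 1 := by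
        gcongr
        rw [div_le_one hT0]; exact this
      _ = S ^ 2 := mul_one _
  have hsqrt : Real.exp (-(2 * s) + 1 / 2 * Real.log (1 - s)) ≤ √(c / (c + T)) := by
    refine Real.le_sqrt_of_sq_le ?_
    rw [← Real.exp_nat_mul]
    have : ((2 : ℕ) : ℝ) * (-(2 * s) + 1 / 2 * Real.log (1 - s)) = -(4 * s) + Real.log (1 - s) := by
      push_cast; ring
    rw [this, Real.exp_add, Real.exp_log h1s, Real.exp_neg, le_div_iff₀ (by positivity)]
    have he : 1 ≤ Real.exp (4 * s) := Real.one_le_exp (by positivity)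
    calc (Real.exp (4 * s))⁻¹ * (1 - s) * (c + T)
        ≤ (Real.exp (4 * s))⁻¹ * (1 - s) * (c + Real.exp (4 * s) * (s / (1 - s)) * c) := by gcongr
      _ = c * ((Real.exp (4 * s))⁻¹ * (1 - s) + s) := by field_simp
      _ ≤ c * (1 * (1 - s) + s) := by
        gcongr
        exact inv_le_one_of_one_le₀ he
      _ = c := by ring
  have hw : Real.exp (2 * s * Real.log (4 * s) - Real.log z
      - 2 * s * Real.log (4 + Real.log T)) ≤ ((k : ℝ) + 1) ^ (-(2 * s)) / z := by
    rw [Real.rpow_def_of_pos (by positivity), ← Real.exp_log (by positivity : 0 < z),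
      ← Real.exp_sub, Real.log_exp, Real.exp_le_exp]
    -- Here `4 s (k + 1) ≤ log T + 4 s ≤ log T + 4`, which is where the `4` inside the iterated
    -- logarithm comes from.
    have : Real.log ((k : ℝ) + 1) ≤ Real.log (4 + Real.log T) - Real.log (4 * s) := by
      rw [← Real.log_div (by positivity) (by positivity)]
      refine Real.log_le_log (by positivity) ?_
      rw [le_div_iff₀ (by positivity)]
      linarith
    nlinarith
  calc ENNReal.ofReal (Real.exp (s * (S ^ 2 / (2 * T) - 2 * Real.log (4 + Real.log T)) - gG s))
      ≤ ENNReal.ofReal (((k : ℝ) + 1) ^ (-(2 * s)) / z *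
          (√(c / (c + T)) * Real.exp (S ^ 2 / (2 * (c + T))))) := by
        refine ENNReal.ofReal_le_ofReal ?_
        calc Real.exp (s * (S ^ 2 / (2 * T) - 2 * Real.log (4 + Real.log T)) - gG s)
            = Real.exp (2 * s * Real.log (4 * s) - Real.log z
                - 2 * s * Real.log (4 + Real.log T)) *
              (Real.exp (-(2 * s) + 1 / 2 * Real.log (1 - s)) *
                Real.exp (s * (S ^ 2 / (2 * T)))) := by
              rw [← Real.exp_add, ← Real.exp_add, gG]
              congr 1
              ring
          _ ≤ _ := by gcongr
    _ = ENNReal.ofReal (((k : ℝ) + 1) ^ (-(2 * s)) / z) *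
          ∫⁻ η, ENNReal.ofReal (Real.exp (η * S - η ^ 2 * T / 2))
            ∂(gaussianReal 0 (Real.toNNReal c⁻¹)) := by
        rw [lintegral_exp_gaussianReal_zero hc S hT0.le, ENNReal.ofReal_mul (by positivity)]
    _ ≤ _ := by
        rw [mixturePrior, lintegral_sum_measure]
        simp_rw [lintegral_smul_measure, smul_eq_mul]
        exact ENNReal.le_tsum k

theorem lintegral_exp_gaussianReal_standardized (m : ℝ) {σ : ℝ} (hσ : 0 < σ) (η : ℝ) :
    ∫⁻ y, ENNReal.ofReal (Real.exp (η * ((y - m) / σ) - η ^ 2 / 2))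
      ∂(gaussianReal m (Real.toNNReal (σ ^ 2))) = 1 := by
  have h1 : ∀ y, Real.exp (η * ((y - m) / σ) - η ^ 2 / 2)
      = Real.exp (-(η * m / σ) - η ^ 2 / 2) * Real.exp (η / σ * y) := by
    intro y
    rw [← Real.exp_add]
    congr 1
    ring
  simp_rw [h1]
  rw [← ofReal_integral_eq_lintegral_ofReal
    ((integrable_exp_mul_gaussianReal (η / σ)).const_mul _)
    (Filter.Eventually.of_forall fun y => by positivity), integral_const_mul]
  have h2 := mgf_gaussianReal (p := gaussianReal m (Real.toNNReal (σ ^ 2))) (X := id)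
    Measure.map_id (η / σ)
  simp only [mgf, id] at h2
  rw [h2, ← Real.exp_add, Real.coe_toNNReal _ (by positivity), ENNReal.ofReal_eq_one,
    Real.exp_eq_one_iff]
  field_simp
  ring

/-! ### The filtration of the bandit and its likelihood-ratio martingales. -/

namespace GaussianBandit

variable {Ω : Type*} [mΩ : MeasurableSpace Ω] {P : Measure Ω} {K : ℕ} {μ : Fin K → ℝ} {σ : ℝ}

theorem measurable_arm_history (B : GaussianBandit P K μ σ) {n ℓ : ℕ} (h : ℓ ∈ Finset.Icc 1 n) :
    Measurable[history B.U B.Y B.arm n] (B.arm ℓ) := by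
  have : MeasurableSpace.comap (B.arm ℓ) inferInstance ≤ history B.U B.Y B.arm n :=
    le_sup_of_le_right (le_iSup₂_of_le ℓ h le_sup_left)
  exact Measurable.mono (comap_measurable _) this le_rfl

theorem measurable_reward_history (B : GaussianBandit P K μ σ) {n ℓ : ℕ}
    (h : ℓ ∈ Finset.Icc 1 n) :
    Measurable[history B.U B.Y B.arm n] (fun ω => B.Y ℓ (B.arm ℓ ω) ω) := by
  have : MeasurableSpace.comap (fun ω => B.Y ℓ (B.arm ℓ ω) ω) inferInstance
      ≤ history B.U B.Y B.arm n :=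
    le_sup_of_le_right (le_iSup₂_of_le ℓ h le_sup_right)
  exact Measurable.mono (comap_measurable _) this le_rfl

theorem history_mono (B : GaussianBandit P K μ σ) : Monotone (history B.U B.Y B.arm) := by
  intro m n h
  refine sup_le (le_sup_of_le_left ?_) (le_sup_of_le_right ?_)
  · refine biSup_mono fun ℓ hℓ => ?_
    simp only [Finset.mem_range] at hℓ ⊢
    omega
  · refine biSup_mono fun ℓ hℓ => ?_
    simp only [Finset.mem_Icc] at hℓ ⊢
    omega

theorem history_le (B : GaussianBandit P K μ σ) (n : ℕ) : history B.U B.Y B.arm n ≤ mΩ := by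
  -- The revealed reward is measurable only once its random index is, and the index is measurable
  -- with respect to an earlier history.
  induction n using Nat.strong_induction_on with
  | _ n ih =>
    refine sup_le (iSup₂_le fun ℓ _ => (B.measurable_U ℓ).comap_le) (iSup₂_le fun ℓ hℓ => ?_)
    obtain ⟨h1, h2⟩ := Finset.mem_Icc.mp hℓ
    obtain ⟨k, rfl⟩ : ∃ k, ℓ = k + 1 := ⟨ℓ - 1, by omega⟩
    have harm : Measurable (B.arm (k + 1)) :=
      (B.measurable_arm k).mono (ih k (by omega)) le_rfl
    refine sup_le harm.comap_le (Measurable.comap_le ?_)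
    have hY : Measurable (fun p : Fin K × Ω => B.Y (k + 1) p.1 p.2) :=
      measurable_from_prod_countable_right fun i => B.measurable_Y k i
    exact hY.comp (harm.prodMk measurable_id)

/-- The filtration generated by the exogenous randomness, the selected arms and the revealed
rewards. -/
def filtration (B : GaussianBandit P K μ σ) : Filtration ℕ mΩ where
  seq := history B.U B.Y B.arm
  mono' := B.history_mono
  le' := B.history_le

/-- The sum of the standardized rewards revealed by arm `i` before round `n`. -/
noncomputable def deviation (B : GaussianBandit P K μ σ) (n : ℕ) (i : Fin K) (ω : Ω) : ℝ :=
  ∑ ℓ ∈ Finset.Ico 1 n, if B.arm ℓ ω = i then (B.Y ℓ (B.arm ℓ ω) ω - μ i) / σ else 0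

theorem cast_pulls_eq_sum (B : GaussianBandit P K μ σ) (n : ℕ) (i : Fin K) (ω : Ω) :
    (B.pulls n i ω : ℝ) = ∑ ℓ ∈ Finset.Ico 1 n, if B.arm ℓ ω = i then 1 else 0 := by
  rw [pulls, Finset.sum_boole]

theorem deviation_eq (B : GaussianBandit P K μ σ) {n : ℕ} {i : Fin K} {ω : Ω}
    (h : 0 < B.pulls n i ω) :
    B.deviation n i ω = B.pulls n i ω * (B.empMean n i ω - μ i) / σ := by
  have h' : (B.pulls n i ω : ℝ) ≠ 0 := by positivity
  rw [empMean, mul_sub, mul_div_cancel₀ _ h', deviation, cast_pulls_eq_sum, Finset.sum_mul,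
    ← Finset.sum_sub_distrib, Finset.sum_div]
  refine Finset.sum_congr rfl fun ℓ _ => ?_
  split_ifs <;> simp

theorem measurable_deviation (B : GaussianBandit P K μ σ) (n : ℕ) (i : Fin K) :
    Measurable[history B.U B.Y B.arm n] (B.deviation (n + 1) i) := by
  unfold deviation
  refine Finset.measurable_fun_sum _ fun ℓ hℓ => ?_
  have hℓ' : ℓ ∈ Finset.Icc 1 n := by simp only [Finset.mem_Ico, Finset.mem_Icc] at hℓ ⊢; omega
  refine Measurable.ite (B.measurable_arm_history hℓ' (measurableSet_singleton i)) ?_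
    measurable_const
  exact ((B.measurable_reward_history hℓ').sub_const _).div_const _

theorem measurable_cast_pulls (B : GaussianBandit P K μ σ) (n : ℕ) (i : Fin K) :
    Measurable[history B.U B.Y B.arm n] (fun ω => (B.pulls (n + 1) i ω : ℝ)) := by
  simp_rw [cast_pulls_eq_sum]
  refine Finset.measurable_fun_sum _ fun ℓ hℓ => ?_
  have hℓ' : ℓ ∈ Finset.Icc 1 n := by simp only [Finset.mem_Ico, Finset.mem_Icc] at hℓ ⊢; omega
  exact Measurable.ite (B.measurable_arm_history hℓ' (measurableSet_singleton i))
    measurable_const measurable_const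

/-- The likelihood ratio, before round `n`, of the bandit with means `μ i + σ θ i` with respect to
the bandit with means `μ i`. -/
noncomputable def likelihoodRatio (B : GaussianBandit P K μ σ) (θ : Fin K → ℝ) (n : ℕ) (ω : Ω) :
    ℝ≥0∞ :=
  ∏ i, ENNReal.ofReal
    (Real.exp (θ i * B.deviation n i ω - θ i ^ 2 * (B.pulls n i ω : ℝ) / 2))

theorem likelihoodRatio_one (B : GaussianBandit P K μ σ) (θ : Fin K → ℝ) (ω : Ω) :
    B.likelihoodRatio θ 1 ω = 1 := by
  simp [likelihoodRatio, deviation, pulls]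

/-- Splitting over the value of the selected arm replaces the random reward index by a fixed one, so
that the independence of `Y (n + 1) i` from the history applies to each summand. -/
theorem likelihoodRatio_succ (B : GaussianBandit P K μ σ) (θ : Fin K → ℝ) (n : ℕ) (ω : Ω) :
    B.likelihoodRatio θ (n + 2) ω = ∑ i, (B.likelihoodRatio θ (n + 1) ω *
      {ω | B.arm (n + 1) ω = i}.indicator (fun _ => 1) ω) *
      ENNReal.ofReal (Real.exp (θ i * ((B.Y (n + 1) i ω - μ i) / σ) - θ i ^ 2 / 2)) := by
  rw [Finset.sum_eq_single (B.arm (n + 1) ω)]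
  · rw [Set.indicator_of_mem (by simp), mul_one, likelihoodRatio, likelihoodRatio,
      ← Finset.mul_prod_erase _ _ (Finset.mem_univ (B.arm (n + 1) ω)),
      ← Finset.mul_prod_erase _ _ (Finset.mem_univ (B.arm (n + 1) ω)), mul_right_comm,
      ← ENNReal.ofReal_mul (by positivity), ← Real.exp_add]
    congr 1
    · congr 2
      simp only [deviation, cast_pulls_eq_sum,
        Finset.sum_Ico_succ_top (Nat.succ_le_succ (Nat.zero_le n)), if_true]
      ring
    · refine Finset.prod_congr rfl fun i hi => ?_
      have hi' : B.arm (n + 1) ω ≠ i := (Finset.ne_of_mem_erase hi).symm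
      simp only [deviation, cast_pulls_eq_sum,
        Finset.sum_Ico_succ_top (Nat.succ_le_succ (Nat.zero_le n)), if_neg hi', add_zero]
  · intro i _ hi
    rw [Set.indicator_of_notMem (fun h => hi h.symm)]
    simp
  · simp

/-- The σ-algebra on `α` is a parameter so that joint measurability in `(ω, θ)` can be obtained
relative to a history instead of the ambient σ-algebra. -/
theorem measurable_prod_exp_mul_sub {α : Type*} (m : MeasurableSpace α) {d t : Fin K → α → ℝ}
    (hd : ∀ i, Measurable (d i)) (ht : ∀ i, Measurable (t i)) :
    Measurable (fun p : α × (Fin K → ℝ) =>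
      ∏ i, ENNReal.ofReal (Real.exp (p.2 i * d i p.1 - p.2 i ^ 2 * t i p.1 / 2))) := by
  refine Finset.measurable_fun_prod _ fun i _ => ?_
  have h1 : Measurable (fun p : α × (Fin K → ℝ) => d i p.1) := (hd i).comp measurable_fst
  have h2 : Measurable (fun p : α × (Fin K → ℝ) => t i p.1) := (ht i).comp measurable_fst
  have h3 : Measurable (fun p : α × (Fin K → ℝ) => p.2 i) :=
    (measurable_pi_apply i).comp measurable_snd
  fun_prop

theorem measurable_likelihoodRatio_prod (B : GaussianBandit P K μ σ) (n : ℕ) :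
    Measurable[(history B.U B.Y B.arm n).prod inferInstance]
      (fun p : Ω × (Fin K → ℝ) => B.likelihoodRatio p.2 (n + 1) p.1) := by
  unfold likelihoodRatio
  exact measurable_prod_exp_mul_sub (history B.U B.Y B.arm n) (d := B.deviation (n + 1))
    (t := fun i ω => (B.pulls (n + 1) i ω : ℝ)) (B.measurable_deviation n)
    (B.measurable_cast_pulls n)

theorem measurable_likelihoodRatio (B : GaussianBandit P K μ σ) (θ : Fin K → ℝ) (n : ℕ) :
    Measurable[history B.U B.Y B.arm n] (B.likelihoodRatio θ (n + 1)) := by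
  exact @Measurable.comp Ω (Ω × (Fin K → ℝ)) _ (history B.U B.Y B.arm n)
    ((history B.U B.Y B.arm n).prod inferInstance) _
    (fun p => B.likelihoodRatio p.2 (n + 1) p.1) (fun ω => (ω, θ))
    (B.measurable_likelihoodRatio_prod n)
    (@measurable_prodMk_right _ _ (history B.U B.Y B.arm n) _ θ)

/-- The martingale property, stated without conditional expectations: given the history, the new
factor has mean `1` whichever arm is selected. -/
theorem setLIntegral_likelihoodRatio_succ (B : GaussianBandit P K μ σ) (hσ : 0 < σ)
    (θ : Fin K → ℝ) (n : ℕ) {A : Set Ω} (hA : MeasurableSet[history B.U B.Y B.arm n] A) :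
    ∫⁻ ω in A, B.likelihoodRatio θ (n + 2) ω ∂P = ∫⁻ ω in A, B.likelihoodRatio θ (n + 1) ω ∂P := by
  have hA' := B.history_le n _ hA
  have hL := B.measurable_likelihoodRatio θ n
  have harm : ∀ i, MeasurableSet[history B.U B.Y B.arm n] {ω | B.arm (n + 1) ω = i} :=
    fun i => B.measurable_arm n (measurableSet_singleton i)
  have hf : ∀ i, Measurable[history B.U B.Y B.arm n] (fun ω => A.indicator (fun _ => 1) ω *
      (B.likelihoodRatio θ (n + 1) ω * {ω | B.arm (n + 1) ω = i}.indicator (fun _ => 1) ω)) := fun i =>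
    (measurable_const.indicator hA).mul (hL.mul (measurable_const.indicator (harm i)))
  have hg : ∀ i, Measurable (fun y : ℝ =>
      ENNReal.ofReal (Real.exp (θ i * ((y - μ i) / σ) - θ i ^ 2 / 2))) := fun i => by fun_prop
  have hset : ∀ f : Ω → ℝ≥0∞, ∫⁻ ω in A, f ω ∂P = ∫⁻ ω, A.indicator (fun _ => 1) ω * f ω ∂P := by
    intro f
    rw [← lintegral_indicator hA']
    refine lintegral_congr fun ω => ?_
    by_cases h : ω ∈ A <;> simp [h]
  have hterm : ∀ i, ∫⁻ ω, (A.indicator (fun _ => 1) ω * (B.likelihoodRatio θ (n + 1) ω *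
        {ω | B.arm (n + 1) ω = i}.indicator (fun _ => 1) ω)) *
        ENNReal.ofReal (Real.exp (θ i * ((B.Y (n + 1) i ω - μ i) / σ) - θ i ^ 2 / 2)) ∂P
      = ∫⁻ ω, A.indicator (fun _ => 1) ω * (B.likelihoodRatio θ (n + 1) ω *
        {ω | B.arm (n + 1) ω = i}.indicator (fun _ => 1) ω) ∂P := by
    intro i
    have hY : Measurable[MeasurableSpace.comap (fun ω i => B.Y (n + 1) i ω) inferInstance]
        (fun ω => B.Y (n + 1) i ω) :=
      (measurable_pi_apply i).comp (comap_measurable (fun ω i => B.Y (n + 1) i ω))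
    have hYle : MeasurableSpace.comap (fun ω i => B.Y (n + 1) i ω) inferInstance ≤ mΩ :=
      (measurable_pi_lambda _ fun i => B.measurable_Y n i).comap_le
    rw [lintegral_mul_eq_lintegral_mul_lintegral_of_independent_measurableSpace (B.history_le n)
      hYle (B.indep_Y n).symm (hf i)
      (g := fun ω => ENNReal.ofReal
        (Real.exp (θ i * ((B.Y (n + 1) i ω - μ i) / σ) - θ i ^ 2 / 2))) ((hg i).comp hY),
      ← lintegral_map (hg i) (B.measurable_Y n i), B.law_Y,
      lintegral_exp_gaussianReal_standardized _ hσ, mul_one]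
  simp_rw [hset, likelihoodRatio_succ, Finset.mul_sum, ← mul_assoc]
  simp_rw [← mul_assoc] at hterm hf
  rw [lintegral_finsetSum]
  · simp_rw [hterm]
    rw [← lintegral_finsetSum]
    · refine lintegral_congr fun ω => ?_
      rw [← Finset.mul_sum]
      rw [Finset.sum_eq_single (B.arm (n + 1) ω)]
      · simp
      · intro i _ hi
        rw [Set.indicator_of_notMem (fun h => hi h.symm)]
      · simp
    · exact fun i _ => (hf i).mono (B.history_le n) le_rfl
  · exact fun i _ => ((hf i).mono (B.history_le n) le_rfl).mul
      ((hg i).comp (B.measurable_Y n i))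

/-- Ville's inequality for a mixture of likelihood ratios. -/
theorem mul_measure_exists_le_lintegral_likelihoodRatio (B : GaussianBandit P K μ σ) (hσ : 0 < σ)
    [IsProbabilityMeasure P] (ρ : Measure (Fin K → ℝ)) [IsProbabilityMeasure ρ] (ε : ℝ≥0∞) :
    ε * P {ω | ∃ n, ε ≤ ∫⁻ θ, B.likelihoodRatio θ (n + 1) ω ∂ρ} ≤ 1 := by
  have hprod : ∀ n, Measurable
      (fun p : Ω × (Fin K → ℝ) => B.likelihoodRatio p.2 (n + 1) p.1) := fun n =>
    (B.measurable_likelihoodRatio_prod n).mono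
      (sup_le_sup (MeasurableSpace.comap_mono (B.history_le n)) le_rfl) le_rfl
  refine (mul_measure_exists_le_lintegral P B.filtration
    (fun n ω => ∫⁻ θ, B.likelihoodRatio θ (n + 1) ω ∂ρ) ?_ ?_ ε).trans ?_
  · intro n
    exact @Measurable.lintegral_prod_right' _ _ (history B.U B.Y B.arm n) _ ρ _ _
      (B.measurable_likelihoodRatio_prod n)
  · intro n A hA
    rw [lintegral_lintegral_swap (f := fun ω θ => B.likelihoodRatio θ (n + 2) ω)
        (hprod (n + 1)).aemeasurable,
      lintegral_lintegral_swap (f := fun ω θ => B.likelihoodRatio θ (n + 1) ω)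
        (hprod n).aemeasurable]
    exact (lintegral_congr fun θ => B.setLIntegral_likelihoodRatio_succ hσ θ n hA).le
  · simp [likelihoodRatio_one]

theorem lintegral_likelihoodRatio_pi (B : GaussianBandit P K μ σ) (ν : Fin K → Measure ℝ)
    [∀ i, IsProbabilityMeasure (ν i)] (n : ℕ) (ω : Ω) :
    ∫⁻ θ, B.likelihoodRatio θ n ω ∂(Measure.pi ν) = ∏ i, ∫⁻ η, ENNReal.ofReal
      (Real.exp (η * B.deviation n i ω - η ^ 2 * (B.pulls n i ω : ℝ) / 2)) ∂(ν i) := by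
  set f : Fin K → ℝ → ℝ≥0∞ := fun i η => ENNReal.ofReal
      (Real.exp (η * B.deviation n i ω - η ^ 2 * (B.pulls n i ω : ℝ) / 2)) with hf
  have hfm : ∀ i, Measurable (f i) := fun i => by simp only [hf]; fun_prop
  have h := lintegral_prod_eq_prod_lintegral_of_indepFun Finset.univ
    (fun i (θ : Fin K → ℝ) => f i (θ i)) (iIndepFun_pi (μ := ν) fun i => (hfm i).aemeasurable)
    (fun i => (hfm i).comp (measurable_pi_apply i))
  unfold likelihoodRatio
  rw [h]
  refine Finset.prod_congr rfl fun i _ => ?_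
  rw [← (measurePreserving_eval ν i).lintegral_comp (hfm i)]

end GaussianBandit

/-! ### Bounds on the thresholds. -/

theorem neg_two_le_gG_add_div {s : ℝ} (hs : s ∈ Set.Ioo (1 / 2 : ℝ) 1) {x : ℝ} (hx : 0 ≤ x) :
    -2 ≤ (gG s + x) / s := by
  obtain ⟨hs1, hs2⟩ := hs
  have hs0 : 0 < s := by linarith
  rw [le_div_iff₀ hs0, gG]
  have h1 : Real.log (4 * s) ≤ 2 := by
    have h4 : Real.log (4 * s) ≤ Real.log (2 ^ 2) := Real.log_le_log (by positivity) (by linarith)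
    rw [Real.log_pow] at h4
    have := Real.log_two_lt_d9
    push_cast at h4
    linarith
  have h2 : 0 ≤ Real.log (riemannZeta ((2 * s : ℝ) : ℂ)).re :=
    Real.log_nonneg (one_le_riemannZeta_re (by linarith))
  have h3 : Real.log (1 - s) ≤ 0 := Real.log_nonpos (by linarith) (by linarith)
  nlinarith

theorem bddBelow_image_gG {x : ℝ} (hx : 0 ≤ x) :
    BddBelow ((fun s : ℝ => (gG s + x) / s) '' Set.Ioo (1 / 2 : ℝ) 1) :=
  ⟨-2, Set.forall_mem_image.mpr fun _ hs => neg_two_le_gG_add_div hs hx⟩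

theorem nonempty_image_gG (x : ℝ) :
    ((fun s : ℝ => (gG s + x) / s) '' Set.Ioo (1 / 2 : ℝ) 1).Nonempty :=
  (Set.nonempty_Ioo.mpr (by norm_num)).image _

theorem neg_two_le_CgG {x : ℝ} (hx : 0 ≤ x) : -2 ≤ CgG x :=
  le_csInf (nonempty_image_gG x) (Set.forall_mem_image.mpr fun _ hs => neg_two_le_gG_add_div hs hx)

theorem log_div_nonneg {K : ℕ} (hK : 2 ≤ K) {δ : ℝ} (hδ0 : 0 < δ) (hδ1 : δ < 1) :
    0 ≤ Real.log (((K : ℝ) - 1) / δ) := by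
  have : (2 : ℝ) ≤ K := by exact_mod_cast hK
  refine Real.log_nonneg ?_
  rw [le_div_iff₀ hδ0]
  linarith

theorem dThreshold_pos {K : ℕ} (hK : 2 ≤ K) {δ : ℝ} (hδ0 : 0 < δ) (hδ1 : δ < 1) (n : ℕ) :
    0 < dThreshold K n δ := by
  have h1 := neg_two_le_CgG (div_nonneg (log_div_nonneg hK hδ0 hδ1) zero_le_two)
  -- The iterated logarithm contributes at least `4 log 4 = 8 log 2 > 4`, which beats the `-4`
  -- coming from `2 * CgG`.
  have h2 : Real.log (2 ^ 2) ≤ Real.log (4 + Real.log n) :=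
    Real.log_le_log (by norm_num) (by have := Real.log_natCast_nonneg n; linarith)
  rw [Real.log_pow] at h2
  have := Real.log_two_gt_d9
  push_cast at h2
  rw [dThreshold]
  linarith

/-- After multiplication by `a + b`, the two sides differ by the square of `a p - b q`. -/
theorem mul_div_add_mul_sq_le {a b : ℝ} (ha : 0 < a) (hb : 0 < b) (p q : ℝ) :
    a * b / (a + b) * (p + q) ^ 2 ≤ a * p ^ 2 + b * q ^ 2 := by
  rw [div_mul_eq_mul_div, div_le_iff₀ (by positivity)]
  nlinarith [sq_nonneg (a * p - b * q)]

/-! ### Time-uniform deviation bound for the transportation cost. -/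

namespace GaussianBandit

variable {Ω : Type*} [mΩ : MeasurableSpace Ω] {P : Measure Ω} {K : ℕ} {μ : Fin K → ℝ} {σ : ℝ}

theorem pulls_le (B : GaussianBandit P K μ σ) (n : ℕ) (i : Fin K) (ω : Ω) :
    B.pulls n i ω ≤ n - 1 := by
  have := Finset.card_filter_le (Finset.Ico 1 n) (fun ℓ => B.arm ℓ ω = i)
  rwa [Nat.card_Ico] at this

theorem transportCost_of_lt (B : GaussianBandit P K μ σ) {n : ℕ} {i j : Fin K} {ω : Ω}
    (h : B.empMean n j ω < B.empMean n i ω) :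
    B.transportCost n i j ω = (B.pulls n i ω : ℝ) * B.pulls n j ω /
      ((B.pulls n i ω : ℝ) + B.pulls n j ω) * (B.empMean n i ω - B.empMean n j ω) ^ 2 /
        (2 * σ ^ 2) := by
  rw [transportCost, if_neg (not_le.mpr h), gaussKL, gaussKL, pooledMean]
  -- If neither arm has been pulled, both sides vanish, since division by zero gives zero.
  rcases Nat.eq_zero_or_pos (B.pulls n i ω + B.pulls n j ω) with h0 | h0
  · obtain ⟨h1, h2⟩ := Nat.add_eq_zero_iff.mp h0
    simp [h1, h2]
  · have h0' : (0 : ℝ) < (B.pulls n i ω : ℝ) + B.pulls n j ω := by exact_mod_cast h0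
    field_simp
    ring

theorem pos_of_transportCost_pos (B : GaussianBandit P K μ σ) {n : ℕ} {i j : Fin K} {ω : Ω}
    (h : 0 < B.transportCost n i j ω) :
    0 < B.pulls n i ω ∧ 0 < B.pulls n j ω ∧ B.empMean n j ω < B.empMean n i ω := by
  have hlt : B.empMean n j ω < B.empMean n i ω := by
    by_contra hle
    rw [transportCost, if_pos (not_lt.mp hle)] at h
    exact h.false
  rw [B.transportCost_of_lt hlt] at h
  refine ⟨Nat.pos_of_ne_zero fun h0 => ?_, Nat.pos_of_ne_zero fun h0 => ?_, hlt⟩ <;>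
  · rw [h0] at h
    simp at h

theorem transportCost_le_of_pos (B : GaussianBandit P K μ σ) (hσ : 0 < σ) {n : ℕ} {i j : Fin K}
    {ω : Ω} (hμ : μ i ≤ μ j) (h : 0 < B.transportCost n i j ω) :
    B.transportCost n i j ω ≤ B.deviation n i ω ^ 2 / (2 * B.pulls n i ω) +
      B.deviation n j ω ^ 2 / (2 * B.pulls n j ω) := by
  obtain ⟨hi, hj, hlt⟩ := B.pos_of_transportCost_pos h
  rw [B.transportCost_of_lt hlt, B.deviation_eq hi, B.deviation_eq hj]
  have hi' : (0 : ℝ) < B.pulls n i ω := by exact_mod_cast hi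
  have hj' : (0 : ℝ) < B.pulls n j ω := by exact_mod_cast hj
  set a : ℝ := (B.pulls n i ω : ℝ)
  set b : ℝ := (B.pulls n j ω : ℝ)
  calc a * b / (a + b) * (B.empMean n i ω - B.empMean n j ω) ^ 2 / (2 * σ ^ 2)
      -- Inserting the true means can only widen the nonnegative empirical gap, because `μ i ≤ μ j`.
      ≤ a * b / (a + b) * ((B.empMean n i ω - μ i) + (μ j - B.empMean n j ω)) ^ 2 /
          (2 * σ ^ 2) := by
        have : 0 ≤ B.empMean n i ω - B.empMean n j ω := by linarith
        gcongr
        linarith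
    _ ≤ (a * (B.empMean n i ω - μ i) ^ 2 + b * (μ j - B.empMean n j ω) ^ 2) / (2 * σ ^ 2) := by
        gcongr
        exact mul_div_add_mul_sq_le hi' hj' _ _
    _ = _ := by
        field_simp
        ring

theorem measure_exists_lt_deviation_le (B : GaussianBandit P K μ σ) [IsProbabilityMeasure P]
    (hσ : 0 < σ) {i j : Fin K} (hij : i ≠ j) {s : ℝ} (hs : s ∈ Set.Ioo (1 / 2 : ℝ) 1) (x : ℝ) :
    P {ω | ∃ n, 0 < B.pulls (n + 1) i ω ∧ 0 < B.pulls (n + 1) j ω ∧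
      4 * Real.log (4 + Real.log ((n + 1 : ℕ) : ℝ)) + 2 * ((gG s + x / 2) / s) ≤
        B.deviation (n + 1) i ω ^ 2 / (2 * B.pulls (n + 1) i ω) +
          B.deviation (n + 1) j ω ^ 2 / (2 * B.pulls (n + 1) j ω)} ≤
      ENNReal.ofReal (Real.exp (-x)) := by
  have hs0 : 0 < s := by linarith [hs.1]
  have := isProbabilityMeasure_mixturePrior hs.1
  -- A point mass at `0` gives the other arms the factor `1`, so only arms `i` and `j` enter the
  -- mixture.
  set ν : Fin K → Measure ℝ := fun k => if k = i ∨ k = j then mixturePrior s else Measure.dirac 0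
    with hν
  have hνp : ∀ k, IsProbabilityMeasure (ν k) := fun k => by
    simp only [hν]
    split_ifs <;> infer_instance
  have hville := B.mul_measure_exists_le_lintegral_likelihoodRatio hσ (Measure.pi ν)
    (ENNReal.ofReal (Real.exp x))
  have hx0 : ENNReal.ofReal (Real.exp x) ≠ 0 := by
    simpa using Real.exp_pos x
  rw [mul_comm, ← ENNReal.le_div_iff_mul_le (Or.inl hx0) (Or.inl ENNReal.ofReal_ne_top), one_div,
    ← ENNReal.ofReal_inv_of_pos (Real.exp_pos x), ← Real.exp_neg] at hville
  refine (measure_mono ?_).trans hville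
  rintro ω ⟨n, hi, hj, hle⟩
  refine ⟨n, ?_⟩
  rw [B.lintegral_likelihoodRatio_pi ν]
  have hlog : ∀ k, 0 < B.pulls (n + 1) k ω →
      Real.log (4 + Real.log (B.pulls (n + 1) k ω : ℝ)) ≤
        Real.log (4 + Real.log ((n + 1 : ℕ) : ℝ)) := by
    intro k hk
    have h1 : (B.pulls (n + 1) k ω : ℝ) ≤ ((n + 1 : ℕ) : ℝ) := by
      exact_mod_cast (B.pulls_le (n + 1) k ω).trans (by omega)
    have h2 : (0 : ℝ) < B.pulls (n + 1) k ω := by exact_mod_cast hk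
    have h3 := Real.log_natCast_nonneg (B.pulls (n + 1) k ω)
    have h4 := Real.log_le_log h2 h1
    exact Real.log_le_log (by linarith) (by linarith)
  rw [Finset.prod_eq_mul i j hij]
  · have hνi : ν i = mixturePrior s := if_pos (Or.inl rfl)
    have hνj : ν j = mixturePrior s := if_pos (Or.inr rfl)
    rw [hνi, hνj]
    refine le_trans ?_ (mul_le_mul'
      (ofReal_exp_le_lintegral_mixturePrior hs (B.deviation (n + 1) i ω)
        (by exact_mod_cast hi))
      (ofReal_exp_le_lintegral_mixturePrior hs (B.deviation (n + 1) j ω)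
        (by exact_mod_cast hj)))
    rw [← ENNReal.ofReal_mul (by positivity), ← Real.exp_add]
    refine ENNReal.ofReal_le_ofReal (Real.exp_le_exp.mpr ?_)
    have h1 := hlog i hi
    have h2 := hlog j hj
    have h3 := mul_le_mul_of_nonneg_left hle hs0.le
    have h4 : s * (2 * ((gG s + x / 2) / s)) = 2 * gG s + x := by field_simp
    rw [mul_add, h4] at h3
    nlinarith
  · intro k _ hk
    have hνk : ν k = Measure.dirac 0 := if_neg (by tauto)
    rw [hνk, lintegral_dirac]
    simp
  · simp
  · simp

theorem measure_exists_lt_transportCost_le (B : GaussianBandit P K μ σ) [IsProbabilityMeasure P]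
    (hσ : 0 < σ) (hK : 2 ≤ K) {δ : ℝ} (hδ0 : 0 < δ) (hδ1 : δ < 1) {i j : Fin K} (hμ : μ i < μ j) :
    P {ω | ∃ n, dThreshold K (n + 1) δ < B.transportCost (n + 1) i j ω} ≤
      ENNReal.ofReal (δ / ((K : ℝ) - 1)) := by
  have hij : i ≠ j := fun h => hμ.ne (congrArg μ h)
  have hK' : (2 : ℝ) ≤ K := by exact_mod_cast hK
  set x := Real.log (((K : ℝ) - 1) / δ) with hx
  have hx0 : 0 ≤ x := log_div_nonneg hK hδ0 hδ1
  have hexp : Real.exp (-x) = δ / ((K : ℝ) - 1) := by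
    rw [Real.exp_neg, hx, Real.exp_log (div_pos (by linarith) hδ0), inv_div]
  -- Ville's inequality applies to one `s` at a time. Along a minimizing sequence the events
  -- increase, so continuity from below reaches the infimum without any minimizer.
  obtain ⟨u, hanti, hlim, hmem⟩ := exists_seq_tendsto_sInf (nonempty_image_gG (x / 2))
    (bddBelow_image_gG (div_nonneg hx0 zero_le_two))
  set E : ℕ → Set Ω := fun m => {ω | ∃ n, 0 < B.pulls (n + 1) i ω ∧ 0 < B.pulls (n + 1) j ω ∧
      4 * Real.log (4 + Real.log ((n + 1 : ℕ) : ℝ)) + 2 * u m ≤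
        B.deviation (n + 1) i ω ^ 2 / (2 * B.pulls (n + 1) i ω) +
          B.deviation (n + 1) j ω ^ 2 / (2 * B.pulls (n + 1) j ω)} with hE
  have hEmono : Monotone E := by
    rintro m m' hm ω ⟨n, hi, hj, h⟩
    exact ⟨n, hi, hj, le_trans (by linarith [hanti hm]) h⟩
  have hEle : ∀ m, P (E m) ≤ ENNReal.ofReal (δ / ((K : ℝ) - 1)) := by
    intro m
    obtain ⟨s, hs, hsu⟩ := hmem m
    rw [← hexp]
    simp only [hE, ← hsu]
    exact B.measure_exists_lt_deviation_le hσ hij hs x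
  refine (measure_mono (t := ⋃ m, E m) ?_).trans ?_
  · rintro ω ⟨n, hn⟩
    have hpos := (dThreshold_pos hK hδ0 hδ1 (n + 1)).trans hn
    obtain ⟨hi, hj, -⟩ := B.pos_of_transportCost_pos hpos
    have hle := B.transportCost_le_of_pos hσ hμ.le hpos
    have hlt := hn.trans_le hle
    rw [dThreshold] at hlt
    set W := B.deviation (n + 1) i ω ^ 2 / (2 * B.pulls (n + 1) i ω) +
          B.deviation (n + 1) j ω ^ 2 / (2 * B.pulls (n + 1) j ω) with hW
    have hlt' : sInf ((fun s : ℝ => (gG s + x / 2) / s) '' Set.Ioo (1 / 2 : ℝ) 1) <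
        (W - 4 * Real.log (4 + Real.log ((n + 1 : ℕ) : ℝ))) / 2 := by
      rw [CgG] at hlt
      linarith
    obtain ⟨m, hm⟩ := (hlim.eventually_lt_const hlt').exists
    exact Set.mem_iUnion.mpr ⟨m, n, hi, hj, by linarith⟩
  · rw [hEmono.measure_iUnion]
    exact iSup_le hEle

theorem measure_exists_ne_lt_transportCost_le (B : GaussianBandit P K μ σ)
    [IsProbabilityMeasure P] (hσ : 0 < σ) (hK : 2 ≤ K) {δ : ℝ} (hδ0 : 0 < δ) (hδ1 : δ < 1)
    {best : Fin K} (hbest : ∀ j, j ≠ best → μ j < μ best) :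
    P {ω | ∃ n, 1 ≤ n ∧ ∃ i, i ≠ best ∧ dThreshold K n δ < B.transportCost n i best ω} ≤
      ENNReal.ofReal δ := by
  have hK' : (2 : ℝ) ≤ K := by exact_mod_cast hK
  have hsub : {ω | ∃ n, 1 ≤ n ∧ ∃ i, i ≠ best ∧ dThreshold K n δ < B.transportCost n i best ω} ⊆
      ⋃ i ∈ Finset.univ.erase best,
        {ω | ∃ n, dThreshold K (n + 1) δ < B.transportCost (n + 1) i best ω} := by
    rintro ω ⟨n, hn, i, hi, h⟩
    obtain ⟨m, rfl⟩ : ∃ m, n = m + 1 := ⟨n - 1, by omega⟩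
    exact Set.mem_biUnion (Finset.mem_erase.mpr ⟨hi, Finset.mem_univ i⟩) ⟨m, h⟩
  calc _ ≤ ∑ i ∈ Finset.univ.erase best,
        P {ω | ∃ n, dThreshold K (n + 1) δ < B.transportCost (n + 1) i best ω} :=
        (measure_mono hsub).trans (measure_biUnion_finset_le _ _)
    _ ≤ ∑ i ∈ Finset.univ.erase best, ENNReal.ofReal (δ / ((K : ℝ) - 1)) :=
        Finset.sum_le_sum fun i hi => B.measure_exists_lt_transportCost_le hσ hK hδ0 hδ1
          (hbest i (Finset.ne_of_mem_erase hi))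
    _ = ENNReal.ofReal δ := by
        rw [Finset.sum_const, Finset.card_erase_of_mem (Finset.mem_univ _), Finset.card_univ,
          Fintype.card_fin, ← ENNReal.ofReal_nsmul, nsmul_eq_mul, Nat.cast_sub (by omega),
          Nat.cast_one, mul_div_cancel₀ _ (by linarith)]

end GaussianBandit

/-! ### Gaussian tails and posterior probabilities. -/

theorem ofReal_gaussianPDFReal_le_gaussianReal_Ioc {u : ℝ} (hu : 0 ≤ u) :
    ENNReal.ofReal (gaussianPDFReal 0 1 (u + 1)) ≤ gaussianReal 0 1 (Set.Ioc u (u + 1)) := by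
  rw [gaussianReal_apply _ one_ne_zero]
  calc ENNReal.ofReal (gaussianPDFReal 0 1 (u + 1))
      = ∫⁻ _ in Set.Ioc u (u + 1), gaussianPDF 0 1 (u + 1) := by
        rw [setLIntegral_const, Real.volume_Ioc, add_sub_cancel_left, ENNReal.ofReal_one, mul_one,
          gaussianPDF]
    _ ≤ _ := by
        refine setLIntegral_mono' measurableSet_Ioc fun y hy => ENNReal.ofReal_le_ofReal ?_
        simp only [gaussianPDFReal]
        gcongr
        · linarith [hy.1]
        · exact hy.2

/-- The unit interval after `u` already has mass at least the density at its right end; a second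
interval makes the inequality strict, as needed for `W > d` from `a ≥ c`. -/
theorem gaussianPDFReal_lt_gaussianReal_Ici {u : ℝ} (hu : 0 ≤ u) :
    gaussianPDFReal 0 1 (u + 1) < (gaussianReal 0 1).real (Set.Ici u) := by
  have h1 : ∀ u : ℝ, 0 ≤ u →
      gaussianPDFReal 0 1 (u + 1) ≤ (gaussianReal 0 1).real (Set.Ioc u (u + 1)) := by
    intro u hu
    rw [measureReal_def, ← ENNReal.ofReal_le_iff_le_toReal (measure_ne_top _ _)]
    exact ofReal_gaussianPDFReal_le_gaussianReal_Ioc hu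
  calc gaussianPDFReal 0 1 (u + 1)
      < gaussianPDFReal 0 1 (u + 1) + gaussianPDFReal 0 1 (u + 1 + 1) :=
        lt_add_of_pos_right _ (gaussianPDFReal_pos _ _ _ one_ne_zero)
    _ ≤ (gaussianReal 0 1).real (Set.Ioc u (u + 1)) +
          (gaussianReal 0 1).real (Set.Ioc (u + 1) (u + 1 + 1)) :=
        add_le_add (h1 u hu) (h1 (u + 1) (by linarith))
    _ = (gaussianReal 0 1).real (Set.Ioc u (u + 1) ∪ Set.Ioc (u + 1) (u + 1 + 1)) :=
        (measureReal_union (Set.Ioc_disjoint_Ioc_of_le le_rfl) measurableSet_Ioc).symm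
    _ ≤ _ := measureReal_mono (Set.union_subset
        (fun y hy => hy.1.le) (fun y hy => (by linarith [hy.1] : u ≤ y)))

theorem gaussianReal_real_Ici_zero (m : ℝ) {t : ℝ} (ht : 0 < t) :
    (gaussianReal m (Real.toNNReal (t ^ 2))).real (Set.Ici 0) =
      (gaussianReal 0 1).real (Set.Ici (-m / t)) := by
  have h : gaussianReal m (Real.toNNReal (t ^ 2)) =
      (gaussianReal 0 1).map (fun y => t * y + m) := by
    have h1 := gaussianReal_map_const_mul (μ := 0) (v := 1) t
    have h2 := gaussianReal_map_add_const (μ := t * 0) (v := .mk (t ^ 2) (sq_nonneg _) * 1) m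
    rw [← h1, Measure.map_map (by fun_prop) (by fun_prop)] at h2
    rw [mul_zero, zero_add, mul_one] at h2
    rw [Real.toNNReal_of_nonneg (sq_nonneg t)]
    exact h2.symm
  rw [h, map_measureReal_apply (by fun_prop) measurableSet_Ici]
  congr 1
  ext y
  simp only [Set.mem_preimage, Set.mem_Ici, div_le_iff₀ ht]
  constructor <;> intro h <;> linarith

theorem map_sub_pi_gaussianReal {ι : Type*} [Fintype ι] (m : ι → ℝ) (v : ι → ℝ≥0) {i j : ι}
    (hij : i ≠ j) :
    (Measure.pi fun k => gaussianReal (m k) (v k)).map (fun θ => θ j - θ i) =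
      gaussianReal (m j - m i) (v j + v i) := by
  have hind := (iIndepFun_pi (μ := fun k => gaussianReal (m k) (v k)) (X := fun _ => id)
    (fun _ => aemeasurable_id)).indepFun hij.symm
  have hind' := hind.comp measurable_id measurable_neg
  have hmap : ∀ k, (Measure.pi fun k => gaussianReal (m k) (v k)).map (fun θ => θ k) =
      gaussianReal (m k) (v k) := fun k => (measurePreserving_eval _ k).map_eq
  have hneg : (Measure.pi fun k => gaussianReal (m k) (v k)).map (fun θ => -θ i) =
      gaussianReal (-m i) (v i) := by
    rw [← gaussianReal_map_neg, ← hmap i, Measure.map_map (by fun_prop) (by fun_prop)]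
    rfl
  have := gaussianReal_add_gaussianReal_of_indepFun hind' (hmap j) hneg
  simp only [sub_eq_add_neg]
  exact this

namespace GaussianBandit

variable {Ω : Type*} [mΩ : MeasurableSpace Ω] {P : Measure Ω} {K : ℕ} {μ : Fin K → ℝ} {σ : ℝ}

instance isProbabilityMeasure_posterior (B : GaussianBandit P K μ σ) (n : ℕ) (ω : Ω) :
    IsProbabilityMeasure (B.posterior n ω) := by
  unfold posterior
  infer_instance

theorem transportCost_nonneg (B : GaussianBandit P K μ σ) (n : ℕ) (i j : Fin K) (ω : Ω) :
    0 ≤ B.transportCost n i j ω := by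
  rw [transportCost]
  split_ifs
  · exact le_rfl
  · simp only [gaussKL]
    positivity

/-- The posterior probability that arm `j` is at least as good as arm `i` is larger than a
Gaussian density evaluated in terms of the transportation cost. -/
theorem exp_transportCost_lt_posterior (B : GaussianBandit P K μ σ) (hσ : 0 < σ) {n : ℕ}
    {i j : Fin K} (hij : i ≠ j) {ω : Ω} (hi : 0 < B.pulls n i ω) (hj : 0 < B.pulls n j ω) :
    1 / √(2 * Real.pi) * Real.exp (-(√(B.transportCost n i j ω) + 1 / √2) ^ 2) <
      (B.posterior n ω).real {θ | θ i ≤ θ j} := by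
  have hi' : (0 : ℝ) < B.pulls n i ω := by exact_mod_cast hi
  have hj' : (0 : ℝ) < B.pulls n j ω := by exact_mod_cast hj
  set a : ℝ := (B.pulls n i ω : ℝ) with ha
  set b : ℝ := (B.pulls n j ω : ℝ) with hb
  set t := √(σ ^ 2 / b + σ ^ 2 / a) with ht
  have ht0 : 0 < t := Real.sqrt_pos.mpr (by positivity)
  have ht2 : t ^ 2 = σ ^ 2 / b + σ ^ 2 / a := Real.sq_sqrt (by positivity)
  have hpost : (B.posterior n ω).real {θ | θ i ≤ θ j} = (gaussianReal 0 1).real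
      (Set.Ici (-(B.empMean n j ω - B.empMean n i ω) / t)) := by
    rw [← gaussianReal_real_Ici_zero _ ht0, ht2,
      Real.toNNReal_add (by positivity) (by positivity),
      ← map_sub_pi_gaussianReal (fun k => B.empMean n k ω)
        (fun k => Real.toNNReal (σ ^ 2 / (B.pulls n k ω : ℝ))) hij,
      map_measureReal_apply (by fun_prop) measurableSet_Ici]
    congr 1
    ext θ
    simp
  set W := B.transportCost n i j ω with hW
  have hW0 : 0 ≤ W := B.transportCost_nonneg n i j ω
  -- The standardized posterior gap equals `√(2 * W)` when arm `i` leads, and is nonpositive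
  -- otherwise.
  have hle : -(B.empMean n j ω - B.empMean n i ω) / t ≤ √(2 * W) := by
    rcases le_or_gt (B.empMean n i ω) (B.empMean n j ω) with h | h
    · refine le_trans ?_ (Real.sqrt_nonneg _)
      exact div_nonpos_of_nonpos_of_nonneg (by linarith) ht0.le
    · refine Real.le_sqrt_of_sq_le (le_of_eq ?_)
      rw [hW, B.transportCost_of_lt h, div_pow, ht2]
      field_simp
      ring
  have hexp : 1 / √(2 * Real.pi) * Real.exp (-(√W + 1 / √2) ^ 2) =
      gaussianPDFReal 0 1 (√(2 * W) + 1) := by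
    simp only [gaussianPDFReal, NNReal.coe_one, mul_one, sub_zero, one_div]
    congr 2
    rw [Real.sqrt_mul zero_le_two]
    have h2 : √2 ^ 2 = 2 := Real.sq_sqrt zero_le_two
    field_simp
    rw [h2]
  rw [hexp, hpost]
  exact (gaussianPDFReal_lt_gaussianReal_Ici (Real.sqrt_nonneg _)).trans_le
    (measureReal_mono (Set.Ici_subset_Ici.mpr hle))

theorem dThreshold_lt_transportCost_of_cThreshold_le (B : GaussianBandit P K μ σ) (hσ : 0 < σ)
    {n : ℕ} {δ : ℝ} {i j : Fin K} (hij : i ≠ j) {ω : Ω} (hall : B.AllPulled n ω)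
    (h : cThreshold K n δ ≤ B.optProb n i ω) :
    dThreshold K n δ < B.transportCost n i j ω := by
  have h1 := B.exp_transportCost_lt_posterior hσ hij (hall i) (hall j)
  have h2 : B.optProb n i ω ≤ 1 - (B.posterior n ω).real {θ | θ i ≤ θ j} := by
    rw [← probReal_compl_eq_one_sub (measurableSet_le (by fun_prop) (by fun_prop))]
    exact measureReal_mono fun θ hθ => not_le.mpr (hθ j hij.symm)
  rw [cThreshold] at h
  have h3 := h1.trans_le (by linarith : _ ≤ 1 / √(2 * Real.pi) *
    Real.exp (-(√(dThreshold K n δ) + 1 / √2) ^ 2))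
  rw [mul_lt_mul_iff_right₀ (by positivity), Real.exp_lt_exp, neg_lt_neg_iff,
    pow_lt_pow_iff_left₀ (by positivity) (by positivity) two_ne_zero, add_lt_add_iff_right] at h3
  -- Monotonicity of the square root holds on all of `ℝ`, so no sign of the threshold is needed.
  exact lt_of_not_ge fun hle => h3.not_ge (Real.sqrt_le_sqrt hle)

theorem toNat_sInf_mem {S : Set ℕ} (h : sInf ((fun n : ℕ => (n : ℕ∞)) '' S) < ⊤) :
    (sInf ((fun n : ℕ => (n : ℕ∞)) '' S)).toNat ∈ S := by
  have hne : ((fun n : ℕ => (n : ℕ∞)) '' S).Nonempty := by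
    rw [Set.nonempty_iff_ne_empty]
    intro h0
    rw [h0, sInf_empty] at h
    exact h.false
  obtain ⟨n, hn, hn'⟩ := csInf_mem hne
  simp only at hn'
  rw [← hn', ENat.toNat_natCast]
  exact hn

end GaussianBandit

end TopTwo

/-! ### Reduction of both stopping rules to the deviation bound. -/

theorem theorem2 {Ω : Type*} [MeasurableSpace Ω] (P : Measure Ω) [IsProbabilityMeasure P]
    {K : ℕ} (hK : 2 ≤ K) (μ : Fin K → ℝ) (σ : ℝ) (hσ : 0 < σ)
    (best : Fin K) (hbest : ∀ j, j ≠ best → μ j < μ best)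
    (B : TopTwo.GaussianBandit P K μ σ) (δ : ℝ) (hδ0 : 0 < δ) (hδ1 : δ < 1) :
    (∀ J : ℕ → Ω → Fin K, B.IsBayesRecommendation J →
      P {ω | B.bayesStop δ ω < ⊤ ∧ J (B.bayesStop δ ω).toNat ω ≠ best} ≤ ENNReal.ofReal δ) ∧
    (∀ J : ℕ → Ω → Fin K, B.IsEmpiricalRecommendation J →
      P {ω | B.chernoffStop δ ω < ⊤ ∧ J (B.chernoffStop δ ω).toNat ω ≠ best} ≤
        ENNReal.ofReal δ) := by
  have : Nonempty (Fin K) := ⟨best⟩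
  refine ⟨fun J hJ => ?_, fun J hJ => ?_⟩ <;>
    refine (measure_mono ?_).trans
      (B.measure_exists_ne_lt_transportCost_le hσ hK hδ0 hδ1 hbest)
  · rintro ω ⟨hfin, hne⟩
    obtain ⟨hn, hall, hc⟩ := TopTwo.GaussianBandit.toNat_sInf_mem hfin
    exact ⟨_, hn, _, hne, B.dThreshold_lt_transportCost_of_cThreshold_le hσ hne hall
      (hc.trans (ciSup_le (hJ _ ω hall)))⟩
  · rintro ω ⟨hfin, hne⟩
    obtain ⟨hn, hd⟩ := TopTwo.GaussianBandit.toNat_sInf_mem hfin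
    change 1 ≤ (B.chernoffStop δ ω).toNat at hn
    change TopTwo.dThreshold K (B.chernoffStop δ ω).toNat δ < _ at hd
    set n := (B.chernoffStop δ ω).toNat
    obtain ⟨i, hi⟩ := exists_lt_of_lt_ciSup hd
    have hlt : ∀ j, j ≠ i → TopTwo.dThreshold K n δ < B.transportCost n i j ω := fun j hj =>
      hi.trans_le (ciInf_le (Set.finite_range _).bddBelow (⟨j, hj⟩ : {j : Fin K // j ≠ i}))
    have hpos : ∀ j, j ≠ i → _ := fun j hj => B.pos_of_transportCost_pos
      ((TopTwo.dThreshold_pos hK hδ0 hδ1 n).trans (hlt j hj))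
    have hall : B.AllPulled n ω := by
      intro k
      by_cases hk : k = i
      · have : Nontrivial (Fin K) := Fin.nontrivial_iff_two_le.mpr hK
        obtain ⟨j, hj⟩ := exists_ne i
        exact hk ▸ (hpos j hj).1
      · exact (hpos k hk).2.1
    -- Each positive cost `W_n(i, j)` forces a strict empirical lead of `i` over `j`, so
    -- tie-breaking plays no role.
    have hJi : J n ω = i := by
      by_contra hJi
      exact (hpos _ hJi).2.2.not_ge (hJ n ω hall i)
    exact ⟨n, hn, i, hJi ▸ hne, hlt best (hJi ▸ hne).symm⟩
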